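/- Let $(X,Y)$ be a dual pair of real locally convex spaces: a bilinear form $\langle\cdot,\cdot\rangle$ on $Y\times X$ separates the points of $X$ and of $Y$, and the topologies are compatible with it, i.e. the continuous linear functionals on $X$ are exactly the maps $\langle y,\cdot\rangle$ with $y\in Y$, and those on $Y$ are exactly the maps $\langle\cdot,x\rangle$ with $x\in X$. Let $\Phi:X\to\mathbb{R}\cup\{+\infty\}$ be proper, convex and lower semicontinuous, and write $\operatorname{dom}\Phi=\{x\mid\Phi(x)<+\infty\}$ and $[\Phi\le r]=\{x\in X\mid\Phi(x)\le r\}$. For $S\subset X$, $x\in X$ and $\delta\ge 0$ put $\mathrm{N}^{\delta}_{S}(x)=\{x^*\in Y\mid\langle x^*,u-x\rangle\le\delta\ \ \forall u\in S\}$ and $\mathrm{N}_S(x)=\mathrm{N}^0_S(x)$. For a proper function $f:X\to\mathbb{R}\cup\{+\infty\}$, $\varepsilon\ge0$ and $x\in\operatorname{dom}f$ put $$\partial_\varepsilon f(x)=\{x^*\in Y\mid\langle x^*,u-x\rangle\le f(u)-f(x)+\varepsilon\ \ \forall u\in X\},$$ $\partial_\varepsilon f(x)=\emptyset$ if $\varepsilon<0$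 or $x\notin\operatorname{dom}f$, and $\partial f=\partial_0 f$. For $\mu\ge0$, $\mu\Phi$ is the pointwise multiple with $0\cdot(+\infty)=+\infty$, so that $0\Phi$ is the indicator function of $\operatorname{dom}\Phi$. For $\delta\ge 0$ and $\bar x\in X$, the set $$\limsup_{\mu\varepsilon\to\delta,\ \mu\to+\infty}\mu\,\partial_\varepsilon\Phi(\bar x)$$ is the Painlevé–Kuratowski upper limit in the topology of $Y$: it consists of all $v\in Y$ such that for every neighbourhood $W$ of $v$, every $\eta>0$ and every $M\in\mathbb{R}$ there are $\mu,\varepsilon\in\mathbb{R}$ with $\mu\ge M$, $|\mu\varepsilon-\delta|<\eta$ and $\mu\,\partial_\varepsilon\Phi(\bar x)\cap W\neq\emptyset$. Then for every $\bar x\in\operatorname{dom}\Phi$ and every $\delta\ge0$, $$\mathrm{N}^{\delta}_{[\Phi\le\Phi(\bar x)]}(\bar x)=\bigcup_{\mu\ge0}\partial_\delta(\mu\Phi)(\bar x)\ \cup\ \limsup_{\mu\varepsilon\to\delta,\ \mu\to+\infty}\mu\,\partial_\varepsilon\Phi(\bar x),$$ and, in particular, $$\mathrm{N}_{[\Phi\le\Phi(\bar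 x)]}(\bar x)=\mathbb{R}_+\partial\Phi(\bar x)\ \cup\ \mathrm{N}_{\operatorname{dom}\Phi}(\bar x)\ \cup\ \limsup_{\mu\varepsilon\to0,\ \mu\to+\infty}\mu\,\partial_\varepsilon\Phi(\bar x),$$ where $\mathbb{R}_+\partial\Phi(\bar x)=\{rx^*\mid r\ge0,\ x^*\in\partial\Phi(\bar x)\}$. Moreover, if Slater's condition holds at $\Phi(\bar x)$, that is, if $\Phi(x_0)<\Phi(\bar x)$ for some $x_0\in X$, then for every $\delta\ge0$ $$\mathrm{N}^{\delta}_{[\Phi\le\Phi(\bar x)]}(\bar x)=\bigcup_{\mu\ge0}\partial_\delta(\mu\Phi)(\bar x).$$ -/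

import Mathlib

open Filter Topology
open scoped Pointwise

namespace SublevelNormal

/-- `(X, Y)` is a dual pair under the bilinear form `B`, `⟨y, x⟩ = B x y`: the form separates the
points of both spaces, and the topologies of `X` and `Y` are compatible with it, that is, the
continuous linear functionals on `X` are exactly the maps `⟨y, ·⟩`, `y ∈ Y`, and the continuous
linear functionals on `Y` are exactly the maps `⟨·, x⟩`, `x ∈ X`. -/
structure IsDualPair {X Y : Type*} [AddCommGroup X] [Module ℝ X] [TopologicalSpace X]
    [AddCommGroup Y] [Module ℝ Y] [TopologicalSpace Y] (B : X →ₗ[ℝ] Y →ₗ[ℝ] ℝ) : Prop where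
  separatingLeft : B.SeparatingLeft
  separatingRight : B.SeparatingRight
  compatibleLeft : ∀ f : X →ₗ[ℝ] ℝ, Continuous f ↔ ∃ y : Y, f = B.flip y
  compatibleRight : ∀ g : Y →ₗ[ℝ] ℝ, Continuous g ↔ ∃ x : X, g = B x

section Functions

variable {X : Type*}

/-- The effective domain `{x | Φ x < +∞}`. -/
def dom (Φ : X → EReal) : Set X := {x | Φ x < ⊤}

/-- The sublevel set `[Φ ≤ r]`. -/
def sublevel (Φ : X → EReal) (r : EReal) : Set X := {x | Φ x ≤ r}

/-- The epigraph of `Φ`, a subset of `X × ℝ`. -/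
def epi (Φ : X → EReal) : Set (X × ℝ) := {p | Φ p.1 ≤ (p.2 : EReal)}

/-- `Φ ∈ Γ₀(X)`: `Φ` takes values in `ℝ ∪ {+∞}`, has nonempty effective domain, is convex (its
epigraph is convex) and lower semicontinuous (its epigraph is closed). -/
structure IsGammaZero [AddCommGroup X] [Module ℝ X] [TopologicalSpace X] (Φ : X → EReal) :
    Prop where
  ne_bot : ∀ x, Φ x ≠ ⊥
  dom_nonempty : (dom Φ).Nonempty
  convex_epi : Convex ℝ (epi Φ)
  isClosed_epi : IsClosed (epi Φ)

open Classical in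
/-- The multiple `μΦ`, with the convention `0 · (+∞) = +∞` of convex analysis; thus `0Φ` is the
indicator function of `dom Φ`. -/
noncomputable def scale (μ : ℝ) (Φ : X → EReal) : X → EReal :=
  fun x => if Φ x = ⊤ then ⊤ else (μ : EReal) * Φ x

/-- Slater's condition at the level `r`. -/
def SlaterAt (Φ : X → EReal) (r : EReal) : Prop := ∃ x₀, Φ x₀ < r

end Functions

section Dual

variable {X Y : Type*} [AddCommGroup X] [Module ℝ X] [AddCommGroup Y] [Module ℝ Y]

/-- The `δ`-normal set to `S` at `x`. -/
def normalSet (B : X →ₗ[ℝ] Y →ₗ[ℝ] ℝ) (δ : ℝ) (S : Set X) (x : X) : Set Y :=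
  {y | ∀ u ∈ S, B (u - x) y ≤ δ}

/-- The normal cone to `S` at `x`. -/
def normalCone (B : X →ₗ[ℝ] Y →ₗ[ℝ] ℝ) (S : Set X) (x : X) : Set Y := normalSet B 0 S x

/-- The `ε`-subdifferential of `Φ` at `x`; it is empty if `ε < 0` or `x ∉ dom Φ`. -/
def epsSubdiff (B : X →ₗ[ℝ] Y →ₗ[ℝ] ℝ) (ε : ℝ) (Φ : X → EReal) (x : X) : Set Y :=
  {y | 0 ≤ ε ∧ x ∈ dom Φ ∧ ∀ u, ((B (u - x) y : ℝ) : EReal) ≤ Φ u - Φ x + (ε : EReal)}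

/-- The (exact) subdifferential of `Φ` at `x`. -/
def subdiff (B : X →ₗ[ℝ] Y →ₗ[ℝ] ℝ) (Φ : X → EReal) (x : X) : Set Y := epsSubdiff B 0 Φ x

end Dual

/-- The Painlevé–Kuratowski upper limit of the multifunction `M` along the filter `l`: the points
all of whose neighbourhoods `W` satisfy `∀ Z ∈ l, ∃ u ∈ Z, M u ∩ W ≠ ∅`. -/
def upperLimit {U V : Type*} [TopologicalSpace V] (l : Filter U) (M : U → Set V) : Set V :=
  {v | ∀ W ∈ 𝓝 v, ∀ Z ∈ l, ∃ u ∈ Z, (M u ∩ W).Nonempty}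

/-- The filter on the pairs `(μ, ε)` which expresses `με → δ`, `μ → +∞`. -/
def mulTendstoAtTop (δ : ℝ) : Filter (ℝ × ℝ) :=
  comap (fun p : ℝ × ℝ => p.1 * p.2) (𝓝 δ) ⊓ comap Prod.fst atTop

end SublevelNormal

open SublevelNormal

/-! Both kinds of sets on the right are sets `minorants μ s` of `y` with ⟨y, · - xbar⟩ ≤ μ(Φ -
Φ(xbar)) + s: `∂_δ(μΦ)` has s = δ, and `μ ∂_εΦ` for μ > 0 has s = με. On the sublevel set the μ-term
is nonpositive, so such `y` are s-normal, and s-normality survives limits; this gives ⊇. For ⊆ there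
are two cases. Under Slater's condition a Lagrange multiplier exists
(`exists_mem_minorants_of_slater`). Otherwise xbar minimizes Φ, so any multiplier may be enlarged; a
Farkas-type separation (`mem_closure_minorantCone`) approximates (v, δ) by pairs (y, s) in the
minorant cone, and a large μ with ε = s/μ puts v in the upper limit. -/

namespace SublevelNormal

/-! ### Multiples of a function. -/

section Scale

variable {X : Type*} {Φ : X → EReal}

lemma scale_one (Φ : X → EReal) : scale 1 Φ = Φ := by
  funext x
  unfold scale
  split_ifs with h <;> simp [h]

lemma dom_scale (hbot : ∀ x, Φ x ≠ ⊥) (μ : ℝ) : dom (scale μ Φ) = dom Φ := by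
  ext x
  simp only [dom, scale, Set.mem_ofPred_eq]
  by_cases h : Φ x = ⊤
  · simp [h]
  · lift Φ x to ℝ using ⟨h, hbot x⟩ with r
    rw [if_neg h, ← EReal.coe_mul]
    simp only [EReal.coe_lt_top]

end Scale

/-! ### Minorants and Lagrange multipliers, without topology. -/

section Algebraic

variable {X Y : Type*} [AddCommGroup X] [Module ℝ X] [AddCommGroup Y] [Module ℝ Y]

/-- The set of `y` such that `μ (Φ - a) + s` majorizes `⟨y, · - xbar⟩`. -/
def minorants (B : X →ₗ[ℝ] Y →ₗ[ℝ] ℝ) (Φ : X → EReal) (xbar : X) (a μ s : ℝ) : Set Y :=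
  {y | ∀ p ∈ epi Φ, B (p.1 - xbar) y ≤ μ * (p.2 - a) + s}

/-- The cone of the pairs `(y, s)` with `y ∈ minorants B Φ xbar a μ s` for some `μ ≥ 0`. -/
def minorantCone (B : X →ₗ[ℝ] Y →ₗ[ℝ] ℝ) (Φ : X → EReal) (xbar : X) (a : ℝ) : Set (Y × ℝ) :=
  {q | ∃ μ : ℝ, 0 ≤ μ ∧ q.1 ∈ minorants B Φ xbar a μ q.2}

variable {B : X →ₗ[ℝ] Y →ₗ[ℝ] ℝ} {Φ : X → EReal} {xbar : X} {a : ℝ}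

/-- Since μ ≥ 0, heights above Φ(u) add no constraint. Points outside `dom Φ` carry no epigraph
point, which matches 0 · (+∞) = +∞ when μ = 0. -/
lemma epsSubdiff_scale (hbot : ∀ x, Φ x ≠ ⊥) (ha : Φ xbar = a) {μ δ : ℝ} (hμ : 0 ≤ μ)
    (hδ : 0 ≤ δ) : epsSubdiff B δ (scale μ Φ) xbar = minorants B Φ xbar a μ δ := by
  have hx : xbar ∈ dom Φ := by simp [dom, ha]
  have hsx : scale μ Φ xbar = ((μ * a : ℝ) : EReal) := by
    simp [scale, ha]
  ext y
  simp only [epsSubdiff, minorants, dom_scale hbot, hx, hδ, true_and, Set.mem_ofPred_eq, hsx]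
  constructor
  · rintro h ⟨u, q⟩ hq
    have hq' : Φ u ≤ (q : EReal) := hq
    have htop : Φ u ≠ ⊤ := fun h' => by simp [h'] at hq'
    have hu := h u
    obtain ⟨r, hr⟩ : ∃ r : ℝ, Φ u = r := ⟨_, (EReal.coe_toReal htop (hbot u)).symm⟩
    rw [scale, if_neg htop, hr, ← EReal.coe_mul, ← EReal.coe_sub, ← EReal.coe_add,
      EReal.coe_le_coe_iff] at hu
    rw [hr, EReal.coe_le_coe_iff] at hq'
    have := mul_le_mul_of_nonneg_left hq' hμ
    simp only
    linarith
  · intro h u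
    by_cases htop : Φ u = ⊤
    · rw [scale, if_pos htop, EReal.top_sub_coe, EReal.top_add_coe]
      exact le_top
    · obtain ⟨r, hr⟩ : ∃ r : ℝ, Φ u = r := ⟨_, (EReal.coe_toReal htop (hbot u)).symm⟩
      have := h (u, r) hr.le
      rw [scale, if_neg htop, hr, ← EReal.coe_mul, ← EReal.coe_sub, ← EReal.coe_add,
        EReal.coe_le_coe_iff]
      simp only at this
      linarith

lemma epsSubdiff_eq (hbot : ∀ x, Φ x ≠ ⊥) (ha : Φ xbar = a) {ε : ℝ} (hε : 0 ≤ ε) :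
    epsSubdiff B ε Φ xbar = minorants B Φ xbar a 1 ε := by
  rw [← epsSubdiff_scale hbot ha zero_le_one hε, scale_one]

lemma smul_mem_minorants {μ s c : ℝ} (hc : 0 ≤ c) {y : Y} (hy : y ∈ minorants B Φ xbar a μ s) :
    c • y ∈ minorants B Φ xbar a (c * μ) (c * s) := by
  intro p hp
  have := mul_le_mul_of_nonneg_left (hy p hp) hc
  rw [map_smul, smul_eq_mul]
  linarith

lemma add_mem_minorants {μ s μ' s' : ℝ} {y y' : Y} (hy : y ∈ minorants B Φ xbar a μ s)
    (hy' : y' ∈ minorants B Φ xbar a μ' s') :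
    y + y' ∈ minorants B Φ xbar a (μ + μ') (s + s') := by
  intro p hp
  have h := hy p hp
  have h' := hy' p hp
  rw [map_add]
  linarith

lemma nonneg_of_mem_minorants (ha : Φ xbar = a) {μ s : ℝ} {y : Y}
    (hy : y ∈ minorants B Φ xbar a μ s) : 0 ≤ s := by
  have := hy (xbar, a) ha.le
  simpa using this

lemma minorants_subset_normalSet (ha : Φ xbar = a) (μ s : ℝ) :
    minorants B Φ xbar a μ s ⊆ normalSet B s (sublevel Φ (Φ xbar)) xbar := by
  intro y hy u hu
  have h : Φ u ≤ (a : EReal) := by rw [← ha]; exact hu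
  simpa using hy (u, a) h

lemma minorants_zero_left (hbot : ∀ x, Φ x ≠ ⊥) :
    minorants B Φ xbar a 0 0 = normalCone B (dom Φ) xbar := by
  ext y
  simp only [minorants, normalCone, normalSet, dom, Set.mem_ofPred_eq, zero_mul, zero_add]
  constructor
  · intro h u hu
    exact h (u, (Φ u).toReal) (EReal.coe_toReal hu.ne (hbot u)).ge
  · intro h p hp
    exact h p.1 (lt_of_le_of_lt hp (EReal.coe_lt_top _))

lemma smul_mem_minorantCone {q : Y × ℝ} (hq : q ∈ minorantCone B Φ xbar a) {c : ℝ} (hc : 0 ≤ c) :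
    c • q ∈ minorantCone B Φ xbar a := by
  obtain ⟨μ, hμ, h⟩ := hq
  exact ⟨c * μ, mul_nonneg hc hμ, smul_mem_minorants hc h⟩

lemma convex_minorantCone : Convex ℝ (minorantCone B Φ xbar a) := by
  intro q hq q' hq' c c' hc hc' _
  obtain ⟨μ, hμ, h⟩ := smul_mem_minorantCone hq hc
  obtain ⟨μ', hμ', h'⟩ := smul_mem_minorantCone hq' hc'
  exact ⟨μ + μ', add_nonneg hμ hμ', add_mem_minorants h h'⟩

/-- Lagrange duality for one convex inequality constraint under Slater's condition. -/
theorem exists_mem_minorants_of_slater (hbot : ∀ x, Φ x ≠ ⊥) (hconv : Convex ℝ (epi Φ))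
    (ha : Φ xbar = a) (hS : SlaterAt Φ (Φ xbar)) {δ : ℝ} {y : Y}
    (hy : y ∈ normalSet B δ (sublevel Φ (Φ xbar)) xbar) :
    ∃ μ : ℝ, 0 ≤ μ ∧ y ∈ minorants B Φ xbar a μ δ := by
  have hfeas : ∀ p ∈ epi Φ, p.2 ≤ a → 0 ≤ δ - B (p.1 - xbar) y := by
    intro p hp hpa
    have : p.1 ∈ sublevel Φ (Φ xbar) := by
      change Φ p.1 ≤ Φ xbar
      rw [ha]
      exact le_trans hp (EReal.coe_le_coe_iff.2 hpa)
    linarith [hy p.1 this]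
  -- Epigraph points below level `a` bound the multiplier from above by these ratios, and points
  -- above `a` bound it from below. The multiplier chosen is the largest one allowed, `sInf T`.
  set T : Set ℝ := (fun p : X × ℝ => (δ - B (p.1 - xbar) y) / (a - p.2)) ''
    {p | p ∈ epi Φ ∧ p.2 < a} with hT
  have hT0 : ∀ t ∈ T, 0 ≤ t := by
    rintro _ ⟨p, ⟨hp, hpa⟩, rfl⟩
    exact div_nonneg (hfeas p hp hpa.le) (by linarith)
  have hbdd : BddBelow T := ⟨0, hT0⟩
  have hne : T.Nonempty := by
    obtain ⟨x₀, hx₀⟩ := hS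
    have hr := EReal.coe_toReal hx₀.ne_top (hbot x₀)
    refine Set.Nonempty.image _ ⟨(x₀, (Φ x₀).toReal), hr.ge, ?_⟩
    rw [ha, ← hr, EReal.coe_lt_coe_iff] at hx₀
    exact hx₀
  refine ⟨sInf T, Real.sInf_nonneg hT0, fun p hp => ?_⟩
  rcases lt_trichotomy p.2 a with h | h | h
  · have := csInf_le hbdd (Set.mem_image_of_mem _ ⟨hp, h⟩ : _ ∈ T)
    rw [le_div_iff₀ (by linarith)] at this
    linarith
  · have := hfeas p hp h.le
    rw [h]
    linarith
  · have key : (B (p.1 - xbar) y - δ) / (p.2 - a) ≤ sInf T := by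
      refine le_csInf hne ?_
      rintro _ ⟨w, ⟨hw, hwa⟩, rfl⟩
      have hd : 0 < p.2 - w.2 := by linarith
      -- The weights put the convex combination of `p` and `w` exactly at height `a`, where `hfeas`
      -- applies; clearing denominators compares the lower bound with the upper one.
      have hmem := hconv hp hw (a := (a - w.2) / (p.2 - w.2)) (b := (p.2 - a) / (p.2 - w.2))
        (div_nonneg (by linarith) hd.le) (div_nonneg (by linarith) hd.le)
        (by field_simp; ring)
      have h2 := hfeas _ hmem (le_of_eq (by
        simp only [Prod.snd_add, Prod.smul_snd, smul_eq_mul]; field_simp; ring))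
      simp only [Prod.fst_add, Prod.smul_fst, map_sub, map_add, map_smul, LinearMap.sub_apply,
        LinearMap.add_apply, LinearMap.smul_apply, smul_eq_mul] at h2 ⊢
      rw [div_le_div_iff₀ (by linarith) (by linarith)]
      have h3 := mul_nonneg h2 hd.le
      have h4 : (δ - ((a - w.2) / (p.2 - w.2) * B p.1 y + (p.2 - a) / (p.2 - w.2) * B w.1 y
          - B xbar y)) * (p.2 - w.2) = δ * (p.2 - w.2) - ((a - w.2) * B p.1 y
          + (p.2 - a) * B w.1 y - B xbar y * (p.2 - w.2)) := by
        field_simp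
      rw [h4] at h3
      linarith
    rw [div_le_iff₀ (by linarith)] at key
    linarith

theorem iUnion_subdiff_scale (hbot : ∀ x, Φ x ≠ ⊥) (ha : Φ xbar = a) :
    (⋃ μ ∈ Set.Ici (0 : ℝ), epsSubdiff B 0 (scale μ Φ) xbar) =
      Set.Ici (0 : ℝ) • subdiff B Φ xbar ∪ normalCone B (dom Φ) xbar := by
  ext y
  simp only [Set.mem_iUnion, Set.mem_Ici, exists_prop, Set.mem_union, subdiff,
    epsSubdiff_eq hbot ha le_rfl, ← minorants_zero_left (a := a) hbot]
  constructor
  · rintro ⟨μ, hμ, hy⟩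
    rw [epsSubdiff_scale hbot ha hμ le_rfl] at hy
    rcases hμ.eq_or_lt with rfl | hpos
    · exact Or.inr hy
    · refine Or.inl ⟨μ, hμ, μ⁻¹ • y, ?_, ?_⟩
      · simpa [hpos.ne'] using smul_mem_minorants (inv_nonneg.2 hμ) hy
      · simp [smul_smul, hpos.ne']
  · rintro (⟨μ, hμ, z, hz, rfl⟩ | hy)
    · refine ⟨μ, hμ, ?_⟩
      rw [epsSubdiff_scale hbot ha hμ le_rfl]
      simpa using smul_mem_minorants hμ hz
    · refine ⟨0, le_rfl, ?_⟩
      rwa [epsSubdiff_scale hbot ha le_rfl le_rfl]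

end Algebraic

/-! ### The upper limit consists of δ-normals. -/

section UpperLimit

variable {X Y : Type*} [AddCommGroup X] [Module ℝ X] [TopologicalSpace X]
    [AddCommGroup Y] [Module ℝ Y] [TopologicalSpace Y]
    {B : X →ₗ[ℝ] Y →ₗ[ℝ] ℝ} {Φ : X → EReal} {xbar : X} {a : ℝ}

theorem upperLimit_subset_normalSet (hB : IsDualPair B) (hbot : ∀ x, Φ x ≠ ⊥)
    (ha : Φ xbar = a) (δ : ℝ) :
    upperLimit (mulTendstoAtTop δ) (fun p => p.1 • epsSubdiff B p.2 Φ xbar) ⊆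
      normalSet B δ (sublevel Φ (Φ xbar)) xbar := by
  intro v hv u hu
  have hcont : Continuous (B (u - xbar)) := (hB.compatibleRight _).2 ⟨_, rfl⟩
  by_contra! hlt
  obtain ⟨c, hc1, hc2⟩ := exists_between hlt
  -- For μ ≥ 0, elements of `μ ∂_εΦ` are με-normal; keeping με < c contradicts a value above `c` at
  -- `u`.
  have hZ : {p : ℝ × ℝ | p.1 * p.2 < c ∧ 0 ≤ p.1} ∈ mulTendstoAtTop δ :=
    inter_mem (mem_inf_of_left (preimage_mem_comap (Iio_mem_nhds hc1)))
      (mem_inf_of_right (preimage_mem_comap (Ici_mem_atTop (0 : ℝ))))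
  obtain ⟨⟨μ, ε⟩, ⟨hμε, hμ⟩, _, ⟨z, hz, rfl⟩, hzc⟩ :=
    hv _ (hcont.continuousAt.eventually (lt_mem_nhds hc2)) _ hZ
  simp only at hμε hμ hz hzc
  rw [epsSubdiff_eq hbot ha hz.1] at hz
  have h := mul_le_mul_of_nonneg_left (minorants_subset_normalSet ha _ _ hz u hu) hμ
  change c < B (u - xbar) (μ • z) at hzc
  rw [map_smul, smul_eq_mul] at hzc
  linarith

end UpperLimit

/-! ### Separation in `X × ℝ` and in `Y × ℝ`. -/

section Topological

variable {X Y : Type*}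
    [AddCommGroup X] [Module ℝ X] [TopologicalSpace X] [IsTopologicalAddGroup X]
    [ContinuousSMul ℝ X] [LocallyConvexSpace ℝ X]
    [AddCommGroup Y] [Module ℝ Y] [TopologicalSpace Y]
    {B : X →ₗ[ℝ] Y →ₗ[ℝ] ℝ} {Φ : X → EReal} {xbar : X} {a : ℝ}

/-- A point outside the sublevel set is cut off by an element of the minorant cone. -/
theorem exists_minorantCone_of_notMem_sublevel (hB : IsDualPair B) (hΦ : IsGammaZero Φ)
    (ha : Φ xbar = a) {x : X} (hx : x ∉ sublevel Φ (Φ xbar)) :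
    ∃ q ∈ minorantCone B Φ xbar a, q.2 < B (x - xbar) q.1 := by
  have hlt : (a : EReal) < Φ x := by
    rw [← ha]
    exact not_le.1 hx
  obtain ⟨r, har, hr⟩ := EReal.lt_iff_exists_real_btwn.1 hlt
  rw [EReal.coe_lt_coe_iff] at har
  obtain ⟨f, β, hf, hβ⟩ := geometric_hahn_banach_closed_point hΦ.convex_epi hΦ.isClosed_epi
    (show (x, r) ∉ epi Φ from not_le.2 hr)
  obtain ⟨y, hy⟩ := (hB.compatibleLeft (f.comp (ContinuousLinearMap.inl ℝ X ℝ)).toLinearMap).1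
    (f.comp (ContinuousLinearMap.inl ℝ X ℝ)).continuous
  have hfy : ∀ (u : X) (q : ℝ), f (u, q) = B u y + q * f (0, 1) := by
    intro u q
    have h1 : f (u, 0) = B u y := by simpa using LinearMap.congr_fun hy u
    have h2 : ((u, q) : X × ℝ) = (u, 0) + q • (0, 1) := by ext <;> simp
    rw [h2, map_add, map_smul, h1, smul_eq_mul]
  set τ : ℝ := -f (0, 1) with hτ
  have hbound : ∀ p ∈ epi Φ, B p.1 y - τ * p.2 < β := by
    intro p hp
    have := hf p hp
    rw [show p = (p.1, p.2) from rfl, hfy] at this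
    rw [hτ]
    linarith
  have hval : β < B x y - τ * r := by
    rw [hfy] at hβ
    rw [hτ]
    linarith
  have hτ0 : 0 ≤ τ := by
    by_contra! hneg
    -- If τ < 0, this height above xbar lifts the functional to at least β.
    have hm := hbound (xbar, a + |β - (B xbar y - τ * a)| / (-τ)) (by
      change Φ xbar ≤ _
      rw [ha, EReal.coe_le_coe_iff]
      exact le_add_of_nonneg_right (div_nonneg (abs_nonneg _) (by linarith)))
    have : τ * (|β - (B xbar y - τ * a)| / (-τ)) = -|β - (B xbar y - τ * a)| := by
      rw [div_neg, mul_neg, mul_div_cancel₀ _ hneg.ne]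
    simp only [mul_add, this] at hm
    linarith [le_abs_self (β - (B xbar y - τ * a))]
  -- The offset is `hbound` recentred at (xbar, a). A vertical hyperplane, τ = 0, is harmless
  -- because the cone admits μ = 0.
  refine ⟨(y, β - B xbar y + τ * a), ⟨τ, hτ0, fun p hp => ?_⟩, ?_⟩
  · have := hbound p hp
    simp only [map_sub, LinearMap.sub_apply]
    linarith
  · have := mul_le_mul_of_nonneg_left har.le hτ0
    simp only [map_sub, LinearMap.sub_apply]
    linarith

variable [IsTopologicalAddGroup Y] [ContinuousSMul ℝ Y] [LocallyConvexSpace ℝ Y]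

/-- The closure of the minorant cone contains `(v, δ)` for every `δ`-normal `v` to the sublevel
set. -/
theorem mem_closure_minorantCone (hB : IsDualPair B) (hΦ : IsGammaZero Φ) (ha : Φ xbar = a)
    {δ : ℝ} {v : Y} (hv : v ∈ normalSet B δ (sublevel Φ (Φ xbar)) xbar) :
    (v, δ) ∈ closure (minorantCone B Φ xbar a) := by
  by_contra hnot
  obtain ⟨f, γ, hf, hγ⟩ := geometric_hahn_banach_closed_point
    (convex_minorantCone (B := B) (Φ := Φ) (xbar := xbar) (a := a)).closure isClosed_closure hnot
  obtain ⟨x, hx⟩ := (hB.compatibleRight (f.comp (ContinuousLinearMap.inl ℝ Y ℝ)).toLinearMap).1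
    (f.comp (ContinuousLinearMap.inl ℝ Y ℝ)).continuous
  set t : ℝ := f (0, 1) with ht
  have hfx : ∀ q : Y × ℝ, f q = B x q.1 + q.2 * t := by
    intro q
    have h1 : f (q.1, 0) = B x q.1 := by simpa using LinearMap.congr_fun hx q.1
    have h2 : q = (q.1, 0) + q.2 • ((0, 1) : Y × ℝ) := by ext <;> simp
    conv_lhs => rw [h2, map_add, map_smul, h1, smul_eq_mul]
  have hnonpos : ∀ q ∈ minorantCone B Φ xbar a, f q ≤ 0 := by
    intro q hq
    by_contra! hpos
    have h := hf _ (subset_closure (smul_mem_minorantCone hq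
      (c := |γ| / f q) (div_nonneg (abs_nonneg _) hpos.le)))
    rw [map_smul, smul_eq_mul, div_mul_cancel₀ _ hpos.ne'] at h
    exact absurd (le_abs_self γ) (not_le.2 h)
  have hzero : (0 : Y × ℝ) ∈ closure (minorantCone B Φ xbar a) :=
    subset_closure ⟨0, le_rfl, fun p _ => by simp⟩
  have hvpos : 0 < f (v, δ) := by
    have := hf _ hzero
    rw [map_zero] at this
    exact this.trans hγ
  have hzone : ((0, 1) : Y × ℝ) ∈ minorantCone B Φ xbar a := ⟨0, le_rfl, fun p _ => by simp⟩
  have ht0 : t ≤ 0 := hnonpos _ hzone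
  rw [hfx] at hvpos
  simp only at hvpos
  -- Tilt the functional so that its last coordinate becomes negative.
  obtain ⟨e, he, hlt⟩ : ∃ e > 0, 0 < B x v + δ * (t - e) := by
    have hc : ContinuousAt (fun e : ℝ => B x v + δ * (t - e)) 0 := by fun_prop
    have hev := (hc.eventually (lt_mem_nhds (by simpa using hvpos))).filter_mono
      (nhdsWithin_le_nhds (s := Set.Ioi (0 : ℝ)))
    obtain ⟨e, he1, he2⟩ := (hev.and self_mem_nhdsWithin).exists
    exact ⟨e, he2, he1⟩
  have hτ : 0 < e - t := by linarith
  -- Dividing by e - t > 0 (t itself may vanish) turns the tilted functional into a point of `X`.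
  -- Inside the sublevel set, the point contradicts δ-normality of `v`; outside, the pair cutting it
  -- off violates `hnonpos`, the tilt being harmless there since q.2 ≥ 0.
  by_cases hmem : xbar + (e - t)⁻¹ • x ∈ sublevel Φ (Φ xbar)
  · have := hv _ hmem
    rw [add_sub_cancel_left, map_smul, LinearMap.smul_apply, smul_eq_mul,
      inv_mul_le_iff₀ hτ] at this
    linarith
  · obtain ⟨q, hq, hlt'⟩ := exists_minorantCone_of_notMem_sublevel hB hΦ ha hmem
    rw [add_sub_cancel_left, map_smul, LinearMap.smul_apply, smul_eq_mul,
      lt_inv_mul_iff₀ hτ] at hlt'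
    obtain ⟨μ, -, hqμ⟩ := id hq
    have hs := nonneg_of_mem_minorants ha hqμ
    have hle := hnonpos q hq
    rw [hfx] at hle
    have := mul_nonneg hs he.le
    linarith

/-- Without Slater's condition Φ ≥ a everywhere, so raising μ only weakens the minorant inequality,
and approximants from the cone can be given arbitrarily large μ. -/
theorem normalSet_subset_upperLimit (hB : IsDualPair B) (hΦ : IsGammaZero Φ)
    (ha : Φ xbar = a) (hS : ¬ SlaterAt Φ (Φ xbar)) (δ : ℝ) :
    normalSet B δ (sublevel Φ (Φ xbar)) xbar ⊆
      upperLimit (mulTendstoAtTop δ) (fun p => p.1 • epsSubdiff B p.2 Φ xbar) := by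
  intro v hv W hW Z hZ
  obtain ⟨Z₁, ⟨N, hN, hNZ⟩, Z₂, ⟨A, hA, hAZ⟩, rfl⟩ := Filter.mem_inf_iff.1 hZ
  obtain ⟨M, hM⟩ := mem_atTop_sets.1 hA
  obtain ⟨⟨y, s⟩, ⟨hyW, hsN⟩, μ, hμ, hy⟩ := mem_closure_iff_nhds.1
    (mem_closure_minorantCone hB hΦ ha hv) _ (prod_mem_nhds hW hN)
  simp only at hyW hsN hy
  -- `M` meets the filter's demand on μ, and 1 makes `m` invertible, so that ε = s/m gives mε = s,
  -- close to δ.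
  set m : ℝ := max (max μ M) 1
  have hm1 : 0 < m := lt_of_lt_of_le one_pos (le_max_right _ _)
  have hym : y ∈ minorants B Φ xbar a m s := by
    intro p hp
    have hpa : a ≤ p.2 := by
      have : Φ xbar ≤ Φ p.1 := not_lt.1 fun h => hS ⟨_, h⟩
      rw [ha] at this
      exact EReal.coe_le_coe_iff.1 (this.trans hp)
    have hμm : μ ≤ m := (le_max_left _ _).trans (le_max_left _ _)
    have := mul_le_mul_of_nonneg_right hμm (sub_nonneg.2 hpa)
    linarith [hy p hp]
  have hs := nonneg_of_mem_minorants ha hym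
  have hms : m * (m⁻¹ * s) = s := mul_inv_cancel_left₀ hm1.ne' s
  refine ⟨(m, m⁻¹ * s), ⟨hNZ ?_, hAZ ?_⟩, y, ⟨m⁻¹ • y, ?_, ?_⟩, hyW⟩
  · simpa only [Set.mem_preimage, hms] using hsN
  · exact hM _ ((le_max_right _ _).trans (le_max_left _ _))
  · rw [epsSubdiff_eq hΦ.ne_bot ha (mul_nonneg (inv_nonneg.2 hm1.le) hs)]
    have := smul_mem_minorants (inv_nonneg.2 hm1.le) hym
    rwa [inv_mul_cancel₀ hm1.ne'] at this
  · simp [smul_smul, hm1.ne']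

end Topological

end SublevelNormal

theorem corollary3p7 {X Y : Type*}
    [AddCommGroup X] [Module ℝ X] [TopologicalSpace X] [IsTopologicalAddGroup X]
    [ContinuousSMul ℝ X] [LocallyConvexSpace ℝ X]
    [AddCommGroup Y] [Module ℝ Y] [TopologicalSpace Y] [IsTopologicalAddGroup Y]
    [ContinuousSMul ℝ Y] [LocallyConvexSpace ℝ Y]
    (B : X →ₗ[ℝ] Y →ₗ[ℝ] ℝ) (hB : IsDualPair B)
    (Φ : X → EReal) (hΦ : IsGammaZero Φ) (xbar : X) (hx : xbar ∈ dom Φ) :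
    (∀ δ : ℝ, 0 ≤ δ →
      normalSet B δ (sublevel Φ (Φ xbar)) xbar =
        (⋃ μ ∈ Set.Ici (0 : ℝ), epsSubdiff B δ (scale μ Φ) xbar) ∪
          upperLimit (mulTendstoAtTop δ) (fun p => p.1 • epsSubdiff B p.2 Φ xbar)) ∧
    normalCone B (sublevel Φ (Φ xbar)) xbar =
      Set.Ici (0 : ℝ) • subdiff B Φ xbar ∪ normalCone B (dom Φ) xbar ∪
        upperLimit (mulTendstoAtTop 0) (fun p => p.1 • epsSubdiff B p.2 Φ xbar) ∧
    (SlaterAt Φ (Φ xbar) → ∀ δ : ℝ, 0 ≤ δ →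
      normalSet B δ (sublevel Φ (Φ xbar)) xbar =
        ⋃ μ ∈ Set.Ici (0 : ℝ), epsSubdiff B δ (scale μ Φ) xbar) := by
  obtain ⟨a, ha⟩ : ∃ a : ℝ, Φ xbar = a := ⟨_, (EReal.coe_toReal hx.ne (hΦ.ne_bot xbar)).symm⟩
  have hsub : ∀ δ : ℝ, 0 ≤ δ → (⋃ μ ∈ Set.Ici (0 : ℝ), epsSubdiff B δ (scale μ Φ) xbar) ⊆
      normalSet B δ (sublevel Φ (Φ xbar)) xbar := fun δ hδ =>
    Set.iUnion₂_subset fun μ hμ => by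
      rw [epsSubdiff_scale hΦ.ne_bot ha hμ hδ]
      exact minorants_subset_normalSet ha μ δ
  have hslater : SlaterAt Φ (Φ xbar) → ∀ δ : ℝ, 0 ≤ δ →
      normalSet B δ (sublevel Φ (Φ xbar)) xbar =
        ⋃ μ ∈ Set.Ici (0 : ℝ), epsSubdiff B δ (scale μ Φ) xbar := by
    intro hS δ hδ
    refine Set.Subset.antisymm (fun y hy => ?_) (hsub δ hδ)
    obtain ⟨μ, hμ, h⟩ := exists_mem_minorants_of_slater hΦ.ne_bot hΦ.convex_epi ha hS hy
    rw [← epsSubdiff_scale hΦ.ne_bot ha hμ hδ] at h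
    exact Set.mem_iUnion₂.2 ⟨μ, hμ, h⟩
  have hmain : ∀ δ : ℝ, 0 ≤ δ →
      normalSet B δ (sublevel Φ (Φ xbar)) xbar =
        (⋃ μ ∈ Set.Ici (0 : ℝ), epsSubdiff B δ (scale μ Φ) xbar) ∪
          upperLimit (mulTendstoAtTop δ) (fun p => p.1 • epsSubdiff B p.2 Φ xbar) := by
    intro δ hδ
    refine Set.Subset.antisymm ?_
      (Set.union_subset (hsub δ hδ) (upperLimit_subset_normalSet hB hΦ.ne_bot ha δ))
    by_cases hS : SlaterAt Φ (Φ xbar)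
    · exact (hslater hS δ hδ).subset.trans Set.subset_union_left
    · exact (normalSet_subset_upperLimit hB hΦ ha hS δ).trans Set.subset_union_right
  refine ⟨hmain, ?_, hslater⟩
  rw [← iUnion_subdiff_scale hΦ.ne_bot ha]
  exact hmain 0 le_rfl
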